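/- Let $F$ be a field and let $q\in F$ be nonzero and not a root of unity (that is, $q^n\neq 1$ for all integers $n\ge 1$). Let $\mathcal H(q)$ be the unital associative $F$-algebra with generators $A,B$ and the single relation $AB-qBA=1$. Regard it as a Lie algebra under the commutator $[x,y]=xy-yx$, and let $\mathcal L(q)$ be the Lie subalgebra of $\mathcal H(q)$ generated by $A$ and $B$. Put $$[BA]:=[B,A],\qquad P(k,l):=[A,B]^{k+1}A^l,\qquad Q(k,l):=B^l[A,B]^{k+1},\qquad G(k):=[A,B]^{k+2}.$$ Then the vectors $$[BA],\quad A,\quad B,\quad P(k,l),\quad Q(k,l),\quad G(k)\qquad (k\ge 0,\ l\ge 1)$$ form a basis of $\mathcal L(q)$. Write $\{n\}_q=\sum_{j=0}^{n-1}q^j$, $\{n\}_q!=\prod_{j=1}^n\{j\}_q$, $\binom{n}{i}_q=\frac{\{n\}_q!}{\{i\}_q!\,\{n-i\}_q!}$ and, for $0\le i\le n$, $$c_i(k,l,m,n)=(-1)^{n-i}\binom{n}{i}_q\left(q^{(l-n)(i+m+1)+\binom{i+1}{2}}-q^{-n\left(k+m+\frac{n+3}{2}\right)+\binom{n-i}{2}}\right).$$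 The commutation relations of this basis are the following (together with antisymmetry), for all $k,m\ge 0$ and $l,n\ge 1$: 1. $[P(k,l),P(m,n)]=(q^{l(m+1)}-q^{n(k+1)})\,P(k+m+1,l+n)$; $[P(k,l),A]=(1-q^{k+1})\,P(k,l+1)$; $[P(k,l),[BA]]=(1-q^l)\,P(k+1,l)$; $[P(k,l),G(m)]=(q^{l(m+2)}-1)\,P(k+m+2,l)$. 2. $[P(k,l),B]=q^{-(k+1)}\left(\{k+l+1\}_q\,P(k+1,l-1)-\{k+1\}_q\,P(k,l-1)\right)$ if $l\ge 2$; $[P(k,1),B]=q^{-(k+1)}\left(\{k+2\}_q\,G(k)-\{k+1\}_q\,G(k-1)\right)$ if $k\ge 1$; $[P(0,1),B]=q^{-1}\left((1+q)\,G(0)+[BA]\right)$. 3. $$[P(k,l),Q(m,n)]=\begin{cases}(q-1)^{-n}\sum_{i=0}^n c_i(k,l,m,n)\,P(i+k+m+1,l-n), & l>n,\\ (q-1)^{-l}\sum_{i=0}^l c_i(m,n,k,l)\,Q(i+k+m+1,n-l), & l<n,\\ (q-1)^{-l}\sum_{i=0}^l c_i(k,l,m,l)\,G(i+k+m), & l=n.\end{cases}$$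 4. $[A,A]=0$; $[A,[BA]]=(1-q)\,P(0,1)$; $[A,G(m)]=(q^{m+2}-1)\,P(m+1,1)$; $[A,B]=-[BA]$. 5. $[A,Q(m,n)]=q^{-(m+1)}\left(\{m+n+1\}_q\,Q(m+1,n-1)-\{m+1\}_q\,Q(m,n-1)\right)$ if $n\ge 2$; $[A,Q(m,1)]=q^{-(m+1)}\left(\{m+2\}_q\,G(m)-\{m+1\}_q\,G(m-1)\right)$ if $m\ge 1$; $[A,Q(0,1)]=q^{-1}\left((1+q)\,G(0)+[BA]\right)$. 6. $[[BA],[BA]]=0$; $[[BA],G(m)]=0$; $[[BA],B]=(1-q)\,Q(0,1)$; $[[BA],Q(m,n)]=(1-q^n)\,Q(m+1,n)$. 7. $[G(k),G(m)]=0$; $[G(k),B]=(q^{k+2}-1)\,Q(k+1,1)$; $[G(k),Q(m,n)]=(q^{n(k+2)}-1)\,Q(k+m+2,n)$. 8. $[B,B]=0$; $[B,Q(m,n)]=(1-q^{m+1})\,Q(m,n+1)$; $[Q(k,l),Q(m,n)]=(q^{n(k+1)}-q^{l(m+1)})\,Q(k+m+1,l+n)$. -/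

import Mathlib

open Finset

attribute [local instance 100] LieRing.ofAssociativeRing

namespace QHeisenberg

/-- The two letters. -/
inductive Gen : Type
  | A
  | B

section Algebra

variable {F : Type*} [Field F]

/-- The defining relation `A B = q B A + 1` on the free unital associative algebra. -/
inductive Rel (q : F) : FreeAlgebra F Gen → FreeAlgebra F Gen → Prop
  | comm : Rel q (FreeAlgebra.ι F Gen.A * FreeAlgebra.ι F Gen.B)
      (q • (FreeAlgebra.ι F Gen.B * FreeAlgebra.ι F Gen.A) + 1)

/-- The `q`-deformed Heisenberg algebra: the unital associative `F`-algebra with generators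
`A`, `B` and relation `A B - q B A = 1`. Its Lie bracket is the commutator. -/
def Heis (q : F) : Type _ := RingQuot (Rel q)

noncomputable instance (q : F) : Ring (Heis q) := inferInstanceAs (Ring (RingQuot (Rel q)))

noncomputable instance (q : F) : Algebra F (Heis q) :=
  inferInstanceAs (Algebra F (RingQuot (Rel q)))

/-- The quotient map from the free algebra. -/
noncomputable def Heis.mk (q : F) : FreeAlgebra F Gen →ₐ[F] Heis q :=
  RingQuot.mkAlgHom F (Rel q)

/-- The generator `A`. -/
noncomputable def genA (q : F) : Heis q :=
  Heis.mk q (FreeAlgebra.ι F Gen.A)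

/-- The generator `B`. -/
noncomputable def genB (q : F) : Heis q :=
  Heis.mk q (FreeAlgebra.ι F Gen.B)

/-- The Lie subalgebra of the `q`-deformed Heisenberg algebra generated by `A` and `B`. -/
noncomputable def lieHeis (q : F) : LieSubalgebra F (Heis q) :=
  LieSubalgebra.lieSpan F (Heis q) {genA q, genB q}

/-- The vector `[BA] = [B, A]`. -/
noncomputable def vecBA (q : F) : Heis q := ⁅genB q, genA q⁆

/-- The vector `[A, B]^(k+1) A^l`. -/
noncomputable def vecP (q : F) (k l : ℕ) : Heis q := ⁅genA q, genB q⁆ ^ (k + 1) * genA q ^ l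

/-- The vector `B^l [A, B]^(k+1)`. -/
noncomputable def vecQ (q : F) (k l : ℕ) : Heis q := genB q ^ l * ⁅genA q, genB q⁆ ^ (k + 1)

/-- The vector `[A, B]^(k+2)`. -/
noncomputable def vecG (q : F) (k : ℕ) : Heis q := ⁅genA q, genB q⁆ ^ (k + 2)

/-- The labels of the vectors `[BA]`, `A`, `B`, `[A,B]^(k+1) A^l`, `B^l [A,B]^(k+1)`,
`[A,B]^(k+2)`, with `k ≥ 0` and `l ≥ 1`. -/
inductive BasisIndex : Type
  | BA
  | A
  | B
  | P (k : ℕ) (l : ℕ+)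
  | Q (k : ℕ) (l : ℕ+)
  | G (k : ℕ)

/-- The family of vectors that is to be a basis. -/
noncomputable def basisVec (q : F) : BasisIndex → Heis q
  | .BA => vecBA q
  | .A => genA q
  | .B => genB q
  | .P k l => vecP q k l
  | .Q k l => vecQ q k l
  | .G k => vecG q k

/-- The `q`-number `{n}_q = 1 + q + ⋯ + q^(n-1)`. -/
def qNum (q : F) (n : ℕ) : F := ∑ l ∈ range n, q ^ l

/-- The `q`-factorial `{n}_q! = {1}_q {2}_q ⋯ {n}_q`. -/
def qFact (q : F) (n : ℕ) : F := ∏ l ∈ Icc 1 n, qNum q l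

/-- The `q`-binomial coefficient `{n}_q! / ({i}_q! {n-i}_q!)`, for `i ≤ n`. -/
def qBinom (q : F) (n i : ℕ) : F := qFact q n / (qFact q i * qFact q (n - i))

/-- The coefficient `c_i(k,l,m,n)`, for `i ≤ n`. The halves in the exponents are exact: `n (n+3)`
is even, so that `n (k + m + (n+3)/2) = n (k + m) + n (n+3) / 2`. -/
def coeffC (q : F) (i k l m n : ℕ) : F :=
  (-1) ^ (n - i) * qBinom q n i *
    (q ^ (((l : ℤ) - n) * (i + m + 1) + (Nat.choose (i + 1) 2 : ℕ)) -
      q ^ (-((n * (k + m) + n * (n + 3) / 2 : ℕ) : ℤ) + (Nat.choose (n - i) 2 : ℕ)))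

end Algebra

end QHeisenberg

open QHeisenberg

/-! Put C = [A,B]. The defining relation gives (q-1)BA = C - 1 and (q-1)AB = qC - 1, hence AC = qCA
and CB = qBC. So every bracket of monomials C^e A^l and B^l C^e can be sorted up to powers of q,
once A^n B^n and B^n A^n are known. Both are products of n linear factors in C, which the q-binomial
theorem expands. The two expansions give the two powers of q in `coeffC` (`lie_monoA_monoB`). The
anti-automorphism exchanging A and B fixes C and transfers each formula to the B side.

These formulas keep the span of the proposed vectors closed under brackets
(`lie_mem_span_basisVec`), so it contains the Lie algebra. Conversely, each vector is reached by
brackets whose leading coefficients 1 - q^n or {n}_q are nonzero (`monoA_mem_lieHeis`,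
`comAB_pow_mem_lieHeis`). Independence comes from a representation on sequences where C is diagonal
with distinct eigenvalues q^n (`linearIndependent_monoZ`). -/

namespace QHeisenberg

/-! ### Gaussian binomials and the q-binomial theorem. -/

section QBinomial

variable {F : Type*} [Field F]

lemma qNum_zero (q : F) : qNum q 0 = 0 := by simp [qNum]

lemma qNum_one (q : F) : qNum q 1 = 1 := by simp [qNum]

lemma qNum_succ (q : F) (n : ℕ) : qNum q (n + 1) = qNum q n + q ^ n := by
  simp [qNum, sum_range_succ]

lemma qNum_add (q : F) (m n : ℕ) : qNum q (m + n) = qNum q m + q ^ m * qNum q n := by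
  induction n with
  | zero => simp [qNum_zero]
  | succ n ih => rw [← add_assoc, qNum_succ, qNum_succ, ih]; ring

lemma qNum_mul_sub_one (q : F) (n : ℕ) : qNum q n * (q - 1) = q ^ n - 1 :=
  geom_sum_mul q n

lemma qNum_ne_zero {q : F} (hq : ∀ n : ℕ, 0 < n → q ^ n ≠ 1) {n : ℕ} (hn : 0 < n) :
    qNum q n ≠ 0 := by
  intro h
  have := qNum_mul_sub_one q n
  rw [h, zero_mul] at this
  exact hq n hn (sub_eq_zero.mp this.symm)

lemma qFact_zero (q : F) : qFact q 0 = 1 := by simp [qFact]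

lemma qFact_succ (q : F) (n : ℕ) : qFact q (n + 1) = qFact q n * qNum q (n + 1) := by
  simp [qFact, prod_Icc_succ_top]

lemma qFact_ne_zero {q : F} (hq : ∀ n : ℕ, 0 < n → q ^ n ≠ 1) (n : ℕ) : qFact q n ≠ 0 :=
  prod_ne_zero_iff.mpr fun i hi => qNum_ne_zero hq (by simp at hi; omega)

/-- The Gaussian binomial coefficient, defined by a Pascal rule. -/
def gauss (q : F) : ℕ → ℕ → F
  | _, 0 => 1
  | 0, _ + 1 => 0
  | n + 1, i + 1 => gauss q n i + q ^ (i + 1) * gauss q n (i + 1)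

lemma gauss_zero_right (q : F) (n : ℕ) : gauss q n 0 = 1 := by cases n <;> rfl

lemma gauss_succ_succ (q : F) (n i : ℕ) :
    gauss q (n + 1) (i + 1) = gauss q n i + q ^ (i + 1) * gauss q n (i + 1) := rfl

lemma gauss_eq_zero_of_lt (q : F) {n i : ℕ} (h : n < i) : gauss q n i = 0 := by
  induction n generalizing i with
  | zero => obtain ⟨i, rfl⟩ := Nat.exists_eq_succ_of_ne_zero h.ne'; rfl
  | succ n ih =>
    obtain ⟨i, rfl⟩ := Nat.exists_eq_succ_of_ne_zero (Nat.ne_zero_of_lt h)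
    rw [Nat.succ_eq_add_one, gauss_succ_succ, ih (by omega), ih (by omega)]; simp

/-- The splitting {i+j+2}_q = {i+1}_q + q^(i+1) {j+1}_q matches the two terms of the Pascal rule.
Without division, this holds for every q. -/
lemma gauss_mul_qFact_mul_qFact (q : F) (i j : ℕ) :
    gauss q (i + j) i * (qFact q i * qFact q j) = qFact q (i + j) := by
  induction i generalizing j with
  | zero => simp [gauss_zero_right, qFact_zero]
  | succ i ihi =>
    induction j with
    | zero =>
      have h := ihi 0
      rw [add_zero, qFact_zero, mul_one] at h
      rw [add_zero, gauss_succ_succ, gauss_eq_zero_of_lt q (Nat.lt_succ_self i), qFact_zero,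
        mul_zero, add_zero, mul_one, qFact_succ, ← mul_assoc, h]
    | succ j ihj =>
      have h := ihi (j + 1)
      have e : i + (j + 1) = i + 1 + j := by ring
      rw [e] at h
      rw [← add_assoc (i + 1) j 1, gauss_succ_succ, qFact_succ q (i + 1 + j),
        show i + 1 + j + 1 = (i + 1) + (j + 1) by ring, qNum_add q (i + 1) (j + 1)]
      calc _ = gauss q (i + 1 + j) i * (qFact q i * qFact q (j + 1)) * qNum q (i + 1) +
            q ^ (i + 1) * qNum q (j + 1) *
              (gauss q (i + 1 + j) (i + 1) * (qFact q (i + 1) * qFact q j)) := by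
            rw [qFact_succ q i, qFact_succ q j]; ring
        _ = _ := by rw [h, ihj]; ring

lemma qBinom_eq_gauss {q : F} (hq : ∀ n : ℕ, 0 < n → q ^ n ≠ 1) {n i : ℕ} (h : i ≤ n) :
    qBinom q n i = gauss q n i := by
  obtain ⟨j, rfl⟩ := Nat.exists_eq_add_of_le h
  rw [qBinom, Nat.add_sub_cancel_left, ← gauss_mul_qFact_mul_qFact,
    mul_div_cancel_right₀ _ (mul_ne_zero (qFact_ne_zero hq i) (qFact_ne_zero hq j))]

lemma qBinom_symm (q : F) {n i : ℕ} (h : i ≤ n) : qBinom q n (n - i) = qBinom q n i := by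
  rw [qBinom, qBinom, Nat.sub_sub_self h, mul_comm (qFact q i)]

/-- The `q`-binomial theorem, over a commutative algebra. -/
lemma prod_smul_sub_eq_sum_gauss {R : Type*} [CommRing R] [Algebra F R] (q : F) (n : ℕ)
    (x y : R) :
    ∏ j ∈ range n, (q ^ j • x - y) =
      ∑ i ∈ range (n + 1), ((-1) ^ (n - i) * q ^ (i.choose 2) * gauss q n i) •
        (x ^ i * y ^ (n - i)) := by
  induction n generalizing x with
  | zero => simp [gauss_zero_right]
  | succ n ih =>
    -- Splitting off the factor j = 0 leaves the product for qx, which is why the induction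
    -- generalizes x.
    have h : ∏ j ∈ range (n + 1), (q ^ j • x - y) =
        (x - y) * ∏ j ∈ range n, (q ^ j • (q • x) - y) := by
      rw [prod_range_succ', mul_comm]
      simp [smul_smul, pow_succ]
    have hsum : ∑ i ∈ range (n + 1 + 1),
          ((-1 : F) ^ (n + 1 - i) * q ^ (i.choose 2) * gauss q (n + 1) i) •
            (x ^ i * y ^ (n + 1 - i)) =
        ∑ i ∈ range (n + 1), ((-1 : F) ^ (n - i) * q ^ ((i + 1).choose 2) * gauss q n i) •
            (x ^ (i + 1) * y ^ (n - i)) +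
        ∑ i ∈ range (n + 1 + 1), ((-1 : F) ^ (n + 1 - i) * q ^ (i.choose 2) *
            (q ^ i * gauss q n i)) • (x ^ i * y ^ (n + 1 - i)) := by
      rw [sum_range_succ', sum_range_succ' _ (n + 1), ← add_assoc, ← sum_add_distrib]
      congr 1
      · refine sum_congr rfl fun i _ => ?_
        rw [Nat.add_sub_add_right, ← add_smul, gauss_succ_succ]
        congr 1; ring
      · simp [gauss_zero_right]
    rw [h, ih, hsum, sum_range_succ _ (n + 1), gauss_eq_zero_of_lt q (Nat.lt_succ_self n),
      sub_mul, mul_sum, mul_sum]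
    simp only [mul_zero, zero_smul, add_zero]
    rw [sub_eq_add_neg, ← sum_neg_distrib]
    congr 1
    · refine sum_congr rfl fun i _ => ?_
      rw [smul_pow, smul_mul_assoc, smul_smul, mul_smul_comm, Nat.choose_succ_succ',
        Nat.choose_one_right, ← mul_assoc, ← pow_succ']
      congr 1; ring
    · refine sum_congr rfl fun i hi => ?_
      rw [smul_pow, smul_mul_assoc, smul_smul, mul_smul_comm, ← neg_smul,
        Nat.succ_sub (Nat.lt_succ_iff.mp (mem_range.mp hi)), pow_succ, pow_succ]
      rw [show y * (x ^ i * y ^ (n - i)) = x ^ i * (y ^ (n - i) * y) by ring]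
      congr 1; ring

end QBinomial

/-! ### Sorting monomials with C = [A,B]. -/

section Relations

variable {F : Type*} [Field F]

/-- The commutator `[A, B]`. -/
noncomputable def comAB (q : F) : Heis q := ⁅genA q, genB q⁆

lemma genA_mul_genB (q : F) : genA q * genB q = q • (genB q * genA q) + 1 := by
  have h := RingQuot.mkAlgHom_rel F (Rel.comm (q := q))
  rw [map_mul, map_add, map_smul, map_mul, map_one] at h
  exact h

lemma comAB_def (q : F) : comAB q = genA q * genB q - genB q * genA q := rfl

lemma vecBA_eq (q : F) : vecBA q = -comAB q := (lie_skew _ _).symm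

lemma smul_genB_mul_genA (q : F) : (q - 1) • (genB q * genA q) = comAB q - 1 := by
  rw [comAB_def, genA_mul_genB, sub_smul, one_smul]; abel

lemma smul_genA_mul_genB (q : F) : (q - 1) • (genA q * genB q) = q • comAB q - 1 := by
  rw [comAB_def, genA_mul_genB]
  module

/-- Since C = (q-1)BA + 1, moving A across gives ((q-1)AB + 1)A, whose left factor is qC. -/
lemma genA_mul_comAB (q : F) : genA q * comAB q = q • (comAB q * genA q) := by
  have h : comAB q = (q - 1) • (genB q * genA q) + 1 := by rw [smul_genB_mul_genA]; abel
  have h' : genA q * comAB q = ((q - 1) • (genA q * genB q) + 1) * genA q := by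
    rw [h]; simp only [mul_add, add_mul, mul_smul_comm, smul_mul_assoc, mul_assoc, one_mul, mul_one]
  rw [h', smul_genA_mul_genB, sub_add_cancel, smul_mul_assoc]

lemma comAB_mul_genB (q : F) : comAB q * genB q = q • (genB q * comAB q) := by
  have h : comAB q = (q - 1) • (genB q * genA q) + 1 := by rw [smul_genB_mul_genA]; abel
  have h' : comAB q * genB q = genB q * ((q - 1) • (genA q * genB q) + 1) := by
    rw [h]; simp only [mul_add, add_mul, mul_smul_comm, smul_mul_assoc, mul_assoc, one_mul, mul_one]
  rw [h', smul_genA_mul_genB, sub_add_cancel, mul_smul_comm]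

lemma pow_mul_pow_of_mul_eq_smul {R : Type*} [Ring R] [Algebra F R] {q : F} {x y : R}
    (h : x * y = q • (y * x)) (m n : ℕ) : x ^ m * y ^ n = q ^ (m * n) • (y ^ n * x ^ m) := by
  have h1 : ∀ n, x * y ^ n = q ^ n • (y ^ n * x) := by
    intro n
    induction n with
    | zero => simp
    | succ n ih =>
      rw [pow_succ, ← mul_assoc, ih, smul_mul_assoc, mul_assoc, h, mul_smul_comm, smul_smul,
        mul_assoc, ← pow_succ]
  induction m with
  | zero => simp
  | succ m ih =>
    rw [pow_succ, mul_assoc, h1, mul_smul_comm, ← mul_assoc, ih, smul_mul_assoc, smul_smul,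
      mul_assoc, ← pow_add]
    congr 2; ring

lemma genA_pow_mul_comAB_pow (q : F) (l e : ℕ) :
    genA q ^ l * comAB q ^ e = q ^ (l * e) • (comAB q ^ e * genA q ^ l) :=
  pow_mul_pow_of_mul_eq_smul (genA_mul_comAB q) l e

lemma comAB_pow_mul_genB_pow (q : F) (e l : ℕ) :
    comAB q ^ e * genB q ^ l = q ^ (e * l) • (genB q ^ l * comAB q ^ e) :=
  pow_mul_pow_of_mul_eq_smul (comAB_mul_genB q) e l

/-- The monomial `[A,B]^e A^l`. -/
noncomputable def monoA (q : F) (e l : ℕ) : Heis q := comAB q ^ e * genA q ^ l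

/-- The monomial `B^l [A,B]^e`. -/
noncomputable def monoB (q : F) (e l : ℕ) : Heis q := genB q ^ l * comAB q ^ e

lemma monoA_mul_monoA (q : F) (e l f n : ℕ) :
    monoA q e l * monoA q f n = q ^ (l * f) • monoA q (e + f) (l + n) := by
  simp only [monoA]
  rw [mul_assoc, ← mul_assoc (genA q ^ l), genA_pow_mul_comAB_pow, smul_mul_assoc, mul_smul_comm,
    mul_assoc, ← pow_add, ← mul_assoc, ← pow_add]

lemma lie_monoA_monoA (q : F) (e l f n : ℕ) :
    ⁅monoA q e l, monoA q f n⁆ = (q ^ (l * f) - q ^ (n * e)) • monoA q (e + f) (l + n) := by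
  rw [Ring.lie_def, monoA_mul_monoA, monoA_mul_monoA, add_comm f e, add_comm n l, sub_smul]

lemma lie_monoA_genB {q : F} (hq0 : q ≠ 0) (hq1 : q ≠ 1) (e l : ℕ) :
    ⁅monoA q e (l + 1), genB q⁆ =
      (q ^ e)⁻¹ • (qNum q (e + l + 1) • monoA q (e + 1) l - qNum q e • monoA q e l) := by
  have hq1' : q - 1 ≠ 0 := sub_ne_zero.mpr hq1
  have hqe : q ^ e ≠ 0 := pow_ne_zero _ hq0
  have h1 : (q - 1) • (monoA q e (l + 1) * genB q) =
      q ^ (l + 1) • monoA q (e + 1) l - monoA q e l := by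
    simp only [monoA]
    have h := genA_pow_mul_comAB_pow q l 1
    rw [pow_one, mul_one] at h
    rw [pow_succ (genA q), ← mul_assoc, mul_assoc _ (genA q), ← mul_smul_comm,
      smul_genA_mul_genB, mul_sub, mul_one, mul_smul_comm, mul_assoc, h, mul_smul_comm,
      smul_smul, ← mul_assoc, ← pow_succ, ← pow_succ']
  have h2 : q ^ e • ((q - 1) • (genB q * monoA q e (l + 1))) =
      monoA q (e + 1) l - monoA q e l := by
    have h := comAB_pow_mul_genB_pow q e 1
    rw [pow_one, mul_one] at h
    simp only [monoA]
    rw [smul_comm, ← mul_assoc, ← smul_mul_assoc, ← h, pow_succ' (genA q), mul_assoc,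
      ← mul_assoc (genB q), ← mul_smul_comm, ← smul_mul_assoc, smul_genB_mul_genA, sub_mul,
      one_mul, mul_sub, ← mul_assoc, ← pow_succ]
  -- After scaling by q^e (q-1), the coefficients become q^(e+l+1) - 1 and q^e - 1, which are q-1
  -- times q-numbers.
  apply smul_right_injective _ (mul_ne_zero hqe hq1')
  simp only
  rw [Ring.lie_def, smul_sub, mul_smul, mul_smul, h1, h2, smul_smul,
    mul_right_comm, mul_inv_cancel₀ hqe, one_mul, smul_sub, smul_sub, smul_smul, smul_smul,
    smul_smul, mul_comm _ (qNum q (e + l + 1)), mul_comm _ (qNum q e),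
    qNum_mul_sub_one, qNum_mul_sub_one]
  module

/-- The innermost AB contributes qC - 1, and pulling it left through A^n turns C into q^n C. The
product is taken in F[X] so that the commutative q-binomial theorem applies. -/
lemma smul_genA_pow_mul_genB_pow (q : F) (n : ℕ) :
    (q - 1) ^ n • (genA q ^ n * genB q ^ n) =
      Polynomial.aeval (comAB q) (∏ j ∈ range n, (q ^ j • (q • (Polynomial.X : Polynomial F)) - 1)) := by
  induction n with
  | zero => simp
  | succ n ih =>
    have h := genA_pow_mul_comAB_pow q n 1
    rw [pow_one, mul_one] at h
    rw [prod_range_succ_comm, map_mul, ← ih, mul_smul_comm, pow_succ (genA q),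
      pow_succ' (genB q), ← mul_assoc, mul_assoc _ (genA q), pow_succ, mul_smul,
      ← smul_mul_assoc (q - 1), ← mul_smul_comm (q - 1), smul_genA_mul_genB, mul_sub, mul_smul_comm, h, mul_one,
      ← mul_assoc]
    simp only [map_sub, map_smul, Polynomial.aeval_X, map_one, sub_mul, smul_mul_assoc, one_mul,
      smul_comm q (q ^ n)]

/-- The innermost BA contributes C - 1, and pulling it left through B^n gives q^(-n) C - 1. Clearing
these denominators produces q^(n choose 2). -/
lemma smul_genB_pow_mul_genA_pow (q : F) (n : ℕ) :
    ((q - 1) ^ n * q ^ n.choose 2) • (genB q ^ n * genA q ^ n) =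
      Polynomial.aeval (comAB q) (∏ j ∈ range n, ((Polynomial.X : Polynomial F) - q ^ j • 1)) := by
  induction n with
  | zero => simp
  | succ n ih =>
    have h := comAB_pow_mul_genB_pow q 1 n
    rw [pow_one, one_mul] at h
    have h2 : (q ^ n * (q - 1)) • (genB q ^ (n + 1) * genA q ^ (n + 1)) =
        (comAB q - q ^ n • 1) * (genB q ^ n * genA q ^ n) := by
      rw [pow_succ (genB q), pow_succ' (genA q), ← mul_assoc, mul_assoc _ (genB q), mul_smul,
        ← smul_mul_assoc (q - 1), ← mul_smul_comm (q - 1), smul_genB_mul_genA, mul_sub, sub_mul,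
        smul_sub, ← smul_mul_assoc, ← h, mul_one, sub_mul, smul_mul_assoc, one_mul, mul_assoc]
    rw [prod_range_succ_comm, map_mul, ← ih, mul_smul_comm, map_sub, map_smul,
      Polynomial.aeval_X, map_one, ← h2, smul_smul, Nat.choose_succ_succ', Nat.choose_one_right]
    congr 1; ring

lemma smul_genA_pow_mul_genB_pow_eq_sum {q : F} (hq : ∀ n : ℕ, 0 < n → q ^ n ≠ 1) (n : ℕ) :
    (q - 1) ^ n • (genA q ^ n * genB q ^ n) =
      ∑ i ∈ range (n + 1), ((-1) ^ (n - i) * qBinom q n i * q ^ ((i + 1).choose 2)) •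
        comAB q ^ i := by
  rw [smul_genA_pow_mul_genB_pow, prod_smul_sub_eq_sum_gauss, map_sum]
  refine sum_congr rfl fun i hi => ?_
  rw [qBinom_eq_gauss hq (Nat.lt_succ_iff.mp (mem_range.mp hi)), one_pow, mul_one, smul_pow,
    smul_smul, map_smul, map_pow, Polynomial.aeval_X, Nat.choose_succ_succ', Nat.choose_one_right]
  congr 1; ring

lemma smul_genB_pow_mul_genA_pow_eq_sum {q : F} (hq : ∀ n : ℕ, 0 < n → q ^ n ≠ 1) (n : ℕ) :
    ((q - 1) ^ n * q ^ n.choose 2) • (genB q ^ n * genA q ^ n) =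
      ∑ i ∈ range (n + 1), ((-1) ^ (n - i) * qBinom q n i * q ^ ((n - i).choose 2)) •
        comAB q ^ i := by
  -- Here the q-powers multiply 1 rather than X, so the q-binomial theorem is used with x = 1, y =
  -- X; the sum is then reflected to be indexed by the power of X.
  have h : ∏ j ∈ range n, ((Polynomial.X : Polynomial F) - q ^ j • 1) =
      (-1 : F) ^ n • ∏ j ∈ range n, (q ^ j • 1 - (Polynomial.X : Polynomial F)) := by
    have : ∀ j ∈ range n, ((Polynomial.X : Polynomial F) - q ^ j • 1) =
        (-1 : F) • (q ^ j • 1 - (Polynomial.X : Polynomial F)) := fun j _ => by module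
    rw [prod_congr rfl this, prod_smul, prod_const, card_range]
  rw [smul_genB_pow_mul_genA_pow, h, prod_smul_sub_eq_sum_gauss, map_smul, map_sum, smul_sum,
    ← sum_range_reflect]
  refine sum_congr rfl fun i hi => ?_
  have hi' : i ≤ n := Nat.lt_succ_iff.mp (mem_range.mp hi)
  rw [← qBinom_symm q hi', qBinom_eq_gauss hq (Nat.sub_le n i),
    show n + 1 - 1 - i = n - i by omega, Nat.sub_sub_self hi', one_pow, one_mul, map_smul, map_pow,
    Polynomial.aeval_X, smul_smul]
  congr 1
  obtain ⟨j, rfl⟩ := Nat.exists_eq_add_of_le hi'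
  have : ((-1 : F) ^ i) * (-1) ^ i = 1 := by rw [← mul_pow]; simp
  rw [Nat.add_sub_cancel_left, pow_add]
  linear_combination (-1 : F) ^ j * q ^ (j.choose 2) * gauss q (i + j) j * this

/-- The two orders of multiplication put A^n B^n or B^n A^n in the middle, and each supplies one
term of `coeffC`. Allowing d = 0 covers the case of equal exponents of A and B. -/
lemma lie_monoA_monoB {q : F} (hq0 : q ≠ 0) (hq : ∀ n : ℕ, 0 < n → q ^ n ≠ 1) (k d m n : ℕ) :
    ⁅monoA q (k + 1) (d + n), monoB q (m + 1) n⁆ =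
      ((q - 1) ^ n)⁻¹ • ∑ i ∈ range (n + 1),
        coeffC q i k (d + n) m n • monoA q (i + k + m + 2) d := by
  have hq1 : q - 1 ≠ 0 := sub_ne_zero.mpr (by simpa using hq 1 one_pos)
  have h1 : (q - 1) ^ n • (monoA q (k + 1) (d + n) * monoB q (m + 1) n) =
      ∑ i ∈ range (n + 1), ((-1) ^ (n - i) * qBinom q n i *
        q ^ (d * (i + m + 1) + (i + 1).choose 2)) • monoA q (i + k + m + 2) d := by
    have : monoA q (k + 1) (d + n) * monoB q (m + 1) n =
        (comAB q ^ (k + 1) * genA q ^ d) * ((genA q ^ n * genB q ^ n) * comAB q ^ (m + 1)) := by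
      simp only [monoA, monoB, pow_add, mul_assoc]
    rw [this, ← mul_smul_comm, ← smul_mul_assoc, smul_genA_pow_mul_genB_pow_eq_sum hq, sum_mul,
      mul_sum]
    refine sum_congr rfl fun i _ => ?_
    rw [smul_mul_assoc, mul_smul_comm, ← pow_add, mul_assoc (comAB q ^ (k + 1)),
      genA_pow_mul_comAB_pow, mul_smul_comm,
      smul_smul, ← mul_assoc, ← pow_add, monoA]
    congr 1
    · rw [pow_add _ (d * _), ← add_assoc]; ring
    · congr 2; ring
  have h2 : (q - 1) ^ n • (monoB q (m + 1) n * monoA q (k + 1) (d + n)) =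
      ∑ i ∈ range (n + 1), ((-1) ^ (n - i) * qBinom q n i *
        (q ^ (n * (k + m + 2) + n.choose 2))⁻¹ * q ^ ((n - i).choose 2)) •
          monoA q (i + k + m + 2) d := by
    have e : q ^ (n * (k + m + 2)) • (monoB q (m + 1) n * monoA q (k + 1) (d + n)) =
        comAB q ^ (k + m + 2) * ((genB q ^ n * genA q ^ n) * genA q ^ d) := by
      simp only [monoA, monoB]
      rw [mul_assoc (genB q ^ n), ← mul_assoc (comAB q ^ (m + 1)), ← pow_add, ← mul_assoc,
        ← smul_mul_assoc, show m + 1 + (k + 1) = k + m + 2 by ring, mul_comm n,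
        ← comAB_pow_mul_genB_pow, add_comm d, pow_add (genA q)]
      simp only [mul_assoc]
    have hne : q ^ (n * (k + m + 2) + n.choose 2) ≠ 0 := pow_ne_zero _ hq0
    apply smul_right_injective _ hne
    simp only
    rw [smul_comm, add_comm, pow_add, mul_smul, e, smul_smul, ← mul_smul_comm, ← smul_mul_assoc,
      smul_genB_pow_mul_genA_pow_eq_sum hq, sum_mul, mul_sum, smul_sum]
    refine sum_congr rfl fun i _ => ?_
    rw [smul_mul_assoc, mul_smul_comm, ← mul_assoc, ← pow_add, monoA, smul_smul]
    congr 1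
    · field_simp
    · congr 2; ring
  apply smul_right_injective _ (pow_ne_zero n hq1)
  simp only
  rw [Ring.lie_def, smul_sub, h1, h2, ← sum_sub_distrib, smul_smul,
    mul_inv_cancel₀ (pow_ne_zero n hq1), one_smul]
  refine sum_congr rfl fun i _ => ?_
  rw [← sub_smul, coeffC]
  congr 1
  have e1 : (((d + n : ℕ) : ℤ) - n) * (i + m + 1) + ((i + 1).choose 2 : ℕ) =
      ((d * (i + m + 1) + (i + 1).choose 2 : ℕ) : ℤ) := by push_cast; ring
  have e2 : n * (k + m) + n * (n + 3) / 2 = n * (k + m + 2) + n.choose 2 := by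
    have : n * (n + 3) / 2 = n * 2 + n.choose 2 := by
      rw [Nat.choose_two_right]
      have : n * (n + 3) = n * (n - 1) + n * 2 * 2 := by
        cases n with
        | zero => rfl
        | succ n => simp; ring
      rw [this, Nat.add_mul_div_right _ _ (by norm_num), add_comm]
    rw [this]; ring
  rw [e1, e2, zpow_natCast, zpow_add₀ hq0, zpow_neg, zpow_natCast, zpow_natCast]
  ring

/-! ### The universal property and the symmetry between A and B. -/

/-- The universal property of the `q`-deformed Heisenberg algebra. -/
noncomputable def heisLift {R : Type*} [Ring R] [Algebra F R] (q : F) (x y : R)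
    (h : x * y = q • (y * x) + 1) : Heis q →ₐ[F] R :=
  RingQuot.liftAlgHom F ⟨FreeAlgebra.lift F fun g => Gen.rec x y g, by
    rintro _ _ ⟨⟩
    simpa only [map_mul, map_add, map_smul, map_one, FreeAlgebra.lift_ι_apply] using h⟩

lemma heisLift_mk {R : Type*} [Ring R] [Algebra F R] (q : F) (x y : R)
    (h : x * y = q • (y * x) + 1) (g : Gen) :
    heisLift q x y h (Heis.mk q (FreeAlgebra.ι F g)) = Gen.rec x y g :=
  (RingQuot.liftAlgHom_mkAlgHom_apply F _ _ _).trans (FreeAlgebra.lift_ι_apply _ _)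

lemma heisLift_genA {R : Type*} [Ring R] [Algebra F R] (q : F) (x y : R)
    (h : x * y = q • (y * x) + 1) : heisLift q x y h (genA q) = x := heisLift_mk q x y h Gen.A

lemma heisLift_genB {R : Type*} [Ring R] [Algebra F R] (q : F) (x y : R)
    (h : x * y = q • (y * x) + 1) : heisLift q x y h (genB q) = y := heisLift_mk q x y h Gen.B

/-- The anti-automorphism that exchanges `A` and `B`, with values in the opposite algebra. -/
noncomputable def swapHom (q : F) : Heis q →ₐ[F] (Heis q)ᵐᵒᵖ :=
  heisLift q (MulOpposite.op (genB q)) (MulOpposite.op (genA q)) <| by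
    rw [← MulOpposite.op_mul, ← MulOpposite.op_mul, ← MulOpposite.op_smul, ← MulOpposite.op_one,
      ← MulOpposite.op_add, genA_mul_genB]

/-- The anti-automorphism that exchanges `A` and `B`, as a linear map. -/
noncomputable def swap (q : F) : Heis q →ₗ[F] Heis q :=
  (MulOpposite.opLinearEquiv F).symm.toLinearMap ∘ₗ (swapHom q).toLinearMap

lemma swap_apply (q : F) (x : Heis q) : swap q x = MulOpposite.unop (swapHom q x) := rfl

lemma swap_genA (q : F) : swap q (genA q) = genB q := by
  rw [swap_apply, swapHom, heisLift_genA]; rfl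

lemma swap_genB (q : F) : swap q (genB q) = genA q := by
  rw [swap_apply, swapHom, heisLift_genB]; rfl

lemma swap_mul (q : F) (x y : Heis q) : swap q (x * y) = swap q y * swap q x := by
  simp only [swap_apply, map_mul, MulOpposite.unop_mul]

lemma swap_pow (q : F) (x : Heis q) (n : ℕ) : swap q (x ^ n) = swap q x ^ n := by
  simp only [swap_apply, map_pow, MulOpposite.unop_pow]

lemma swap_lie (q : F) (x y : Heis q) : swap q ⁅x, y⁆ = ⁅swap q y, swap q x⁆ := by
  rw [Ring.lie_def, Ring.lie_def, map_sub, swap_mul, swap_mul]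

lemma swap_comAB (q : F) : swap q (comAB q) = comAB q := by
  rw [comAB, swap_lie, swap_genA, swap_genB]

lemma swap_monoA (q : F) (e l : ℕ) : swap q (monoA q e l) = monoB q e l := by
  rw [monoA, swap_mul, swap_pow, swap_pow, swap_genA, swap_comAB, monoB]

lemma swap_monoB (q : F) (e l : ℕ) : swap q (monoB q e l) = monoA q e l := by
  rw [monoB, swap_mul, swap_pow, swap_pow, swap_genB, swap_comAB, monoA]

lemma lie_monoB_monoB (q : F) (e l f n : ℕ) :
    ⁅monoB q e l, monoB q f n⁆ = (q ^ (n * e) - q ^ (l * f)) • monoB q (e + f) (l + n) := by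
  have h := congrArg (swap q) (lie_monoA_monoA q f n e l)
  rwa [swap_lie, map_smul, swap_monoA, swap_monoA, swap_monoA, add_comm f, add_comm n] at h

lemma lie_genA_monoB {q : F} (hq0 : q ≠ 0) (hq1 : q ≠ 1) (e l : ℕ) :
    ⁅genA q, monoB q e (l + 1)⁆ =
      (q ^ e)⁻¹ • (qNum q (e + l + 1) • monoB q (e + 1) l - qNum q e • monoB q e l) := by
  have h := congrArg (swap q) (lie_monoA_genB hq0 hq1 e l)
  rwa [swap_lie, map_smul, map_sub, map_smul, map_smul, swap_monoA, swap_monoA, swap_monoA,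
    swap_genB] at h

lemma lie_monoA_monoB' {q : F} (hq0 : q ≠ 0) (hq : ∀ n : ℕ, 0 < n → q ^ n ≠ 1) (k l m d : ℕ) :
    ⁅monoA q (k + 1) l, monoB q (m + 1) (d + l)⁆ =
      ((q - 1) ^ l)⁻¹ • ∑ i ∈ range (l + 1),
        coeffC q i m (d + l) k l • monoB q (i + k + m + 2) d := by
  -- `swap` reverses brackets, so the two pairs of exponents enter exchanged; this permutes the
  -- arguments of `coeffC`.
  have h := congrArg (swap q) (lie_monoA_monoB hq0 hq m d k l)
  rw [swap_lie, map_smul, map_sum, swap_monoA, swap_monoB] at h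
  rw [h]
  congr 1
  refine sum_congr rfl fun i _ => ?_
  rw [map_smul, swap_monoA, add_right_comm i]

lemma genA_eq_monoA (q : F) : genA q = monoA q 0 1 := by simp [monoA]

lemma genB_eq_monoB (q : F) : genB q = monoB q 0 1 := by simp [monoB]

lemma vecBA_eq_monoA (q : F) : vecBA q = -monoA q 1 0 := by simp [monoA, vecBA_eq]

lemma vecBA_eq_monoB (q : F) : vecBA q = -monoB q 1 0 := by simp [monoB, vecBA_eq]

lemma vecP_eq_monoA (q : F) (k l : ℕ) : vecP q k l = monoA q (k + 1) l := rfl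

lemma vecQ_eq_monoB (q : F) (k l : ℕ) : vecQ q k l = monoB q (k + 1) l := rfl

lemma vecG_eq_monoA (q : F) (k : ℕ) : vecG q k = monoA q (k + 2) 0 := by
  simp [monoA, vecG, comAB]

lemma vecG_eq_monoB (q : F) (k : ℕ) : vecG q k = monoB q (k + 2) 0 := by
  simp [monoB, vecG, comAB]

end Relations

end QHeisenberg

namespace QHeisenberg

/-! ### Linear independence via a representation on sequences. -/

section Independence

variable {F : Type*} [Field F]

/-- The shift `f ↦ f (· + 1)` on sequences. -/
def shiftEnd (F : Type*) [Field F] : Module.End F (ℕ → F) where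
  toFun f n := f (n + 1)
  map_add' _ _ := rfl
  map_smul' _ _ := rfl

/-- The weighted backward shift `f ↦ ({n}_q f(n-1))` on sequences. -/
def weightedShiftEnd (q : F) : Module.End F (ℕ → F) where
  toFun f n := qNum q n * f (n - 1)
  map_add' _ _ := by ext; simp [mul_add]
  map_smul' _ _ := by ext; simp [mul_left_comm]

lemma shiftEnd_apply (f : ℕ → F) (n : ℕ) : shiftEnd F f n = f (n + 1) := rfl

lemma weightedShiftEnd_apply (q : F) (f : ℕ → F) (n : ℕ) :
    weightedShiftEnd q f n = qNum q n * f (n - 1) := rfl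

lemma shiftEnd_mul_weightedShiftEnd (q : F) : shiftEnd F * weightedShiftEnd q =
    q • (weightedShiftEnd q * shiftEnd F) + 1 := by
  ext f n
  simp only [Module.End.mul_apply, LinearMap.add_apply, LinearMap.smul_apply,
    Pi.add_apply, Pi.smul_apply, shiftEnd_apply, weightedShiftEnd_apply, Module.End.one_apply,
    smul_eq_mul]
  cases n with
  -- The truncated index 0 - 1 is harmless because its weight is {0}_q = 0.
  | zero => simp [qNum_zero, qNum_one]
  | succ n =>
    simp only [Nat.add_sub_cancel]
    rw [add_comm (n + 1) 1, qNum_add, qNum_one]; ring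

/-- The representation of the `q`-deformed Heisenberg algebra on sequences. -/
noncomputable def seqRep (q : F) : Heis q →ₐ[F] Module.End F (ℕ → F) :=
  heisLift q (shiftEnd F) (weightedShiftEnd q) (shiftEnd_mul_weightedShiftEnd q)

lemma seqRep_comAB_apply (q : F) (f : ℕ → F) (n : ℕ) :
    seqRep q (comAB q) f n = q ^ n * f n := by
  rw [comAB_def, map_sub, map_mul, map_mul, seqRep, heisLift_genA, heisLift_genB]
  simp only [LinearMap.sub_apply, Module.End.mul_apply, Pi.sub_apply, shiftEnd_apply,
    weightedShiftEnd_apply]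
  cases n with
  | zero => simp [qNum_zero, qNum_one]
  | succ n => simp only [Nat.add_sub_cancel]; rw [qNum_succ q (n + 1)]; ring

lemma seqRep_comAB_pow_apply (q : F) (e : ℕ) (f : ℕ → F) (n : ℕ) :
    seqRep q (comAB q ^ e) f n = (q ^ n) ^ e * f n := by
  induction e generalizing f with
  | zero => simp
  | succ e ih =>
    rw [pow_succ, map_mul, Module.End.mul_apply, ih, seqRep_comAB_apply, pow_succ, mul_assoc]

lemma seqRep_genA_pow_apply (q : F) (l : ℕ) (f : ℕ → F) (n : ℕ) :
    seqRep q (genA q ^ l) f n = f (n + l) := by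
  induction l generalizing f with
  | zero => simp
  | succ l ih =>
    rw [pow_succ, map_mul, Module.End.mul_apply, ih, seqRep, heisLift_genA, shiftEnd_apply,
      add_assoc]

lemma seqRep_genB_pow_apply_of_lt (q : F) {l n : ℕ} (h : n < l) (f : ℕ → F) :
    seqRep q (genB q ^ l) f n = 0 := by
  induction l generalizing n with
  | zero => omega
  | succ l ih =>
    rw [pow_succ', map_mul, Module.End.mul_apply]
    nth_rewrite 1 [seqRep]
    rw [heisLift_genB, weightedShiftEnd_apply]
    cases n with
    | zero => simp [qNum_zero]
    | succ n => rw [ih (by omega), mul_zero]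

lemma seqRep_genB_pow_apply_add (q : F) (l t : ℕ) (f : ℕ → F) :
    seqRep q (genB q ^ l) f (t + l) = (∏ j ∈ range l, qNum q (t + j + 1)) * f t := by
  induction l with
  | zero => simp
  | succ l ih =>
    rw [pow_succ', map_mul, Module.End.mul_apply]
    nth_rewrite 1 [seqRep]
    rw [heisLift_genB, weightedShiftEnd_apply, ← add_assoc, Nat.add_sub_cancel, ih,
      prod_range_succ]
    ring

/-- The monomial `B^a [A,B]^e A^b` of degree `d = b - a` with `a = 0` or `b = 0`. -/
noncomputable def monoZ (q : F) (i : ℤ × ℕ) : Heis q :=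
  genB q ^ (-i.1).toNat * comAB q ^ i.2 * genA q ^ i.1.toNat

/-- A matrix entry that detects only degree d; within that degree, the exponent of C is seen through
the power (q^t)^e, with t free. -/
lemma seqRep_monoZ_single (q : F) (i : ℤ × ℕ) (d : ℤ) (t : ℕ) :
    seqRep q (monoZ q i) (Pi.single (t + d.toNat) 1) (t + (-d).toNat) =
      if i.1 = d then (∏ j ∈ range (-d).toNat, qNum q (t + j + 1)) * (q ^ t) ^ i.2 else 0 := by
  rw [monoZ, map_mul, map_mul, Module.End.mul_apply, Module.End.mul_apply]
  split_ifs with h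
  · subst h
    rw [seqRep_genB_pow_apply_add, seqRep_comAB_pow_apply, seqRep_genA_pow_apply, Pi.single_eq_same,
      mul_one]
  · rcases lt_or_ge (t + (-d).toNat) (-i.1).toNat with h' | h'
    · exact seqRep_genB_pow_apply_of_lt q h' _
    · obtain ⟨n, hn⟩ := Nat.exists_eq_add_of_le' h'
      rw [hn, seqRep_genB_pow_apply_add, seqRep_comAB_pow_apply, seqRep_genA_pow_apply,
        Pi.single_eq_of_ne (by omega), mul_zero, mul_zero]

lemma pow_injective_of_pow_ne_one {q : F} (hq0 : q ≠ 0) (hq : ∀ n : ℕ, 0 < n → q ^ n ≠ 1) :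
    Function.Injective fun n : ℕ => q ^ n := by
  have key : ∀ m n : ℕ, m < n → q ^ m ≠ q ^ n := by
    intro m n h e
    obtain ⟨d, rfl⟩ := Nat.exists_eq_add_of_lt h
    rw [add_assoc, pow_add] at e
    exact hq (d + 1) d.succ_pos (mul_left_cancel₀ (pow_ne_zero m hq0) (by rw [mul_one, ← e]))
  intro m n e
  rcases lt_trichotomy m n with h | h | h
  · exact absurd e (key m n h)
  · exact h
  · exact absurd e.symm (key n m h)

lemma linearIndependent_monoZ {q : F} (hq0 : q ≠ 0) (hq : ∀ n : ℕ, 0 < n → q ^ n ≠ 1) :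
    LinearIndependent F (monoZ q) := by
  rw [linearIndependent_iff']
  rintro s g hs ⟨d, e⟩ hde
  -- The degree-d coefficients of the relation, with X standing for C. It vanishes at all the q^t,
  -- which are infinitely many since q is not a root of unity.
  let p : Polynomial F := ∑ i ∈ s with i.1 = d, Polynomial.monomial i.2 (g i)
  have hp : ∀ t : ℕ, p.eval (q ^ t) = 0 := by
    intro t
    have hu : ∏ j ∈ range (-d).toNat, qNum q (t + j + 1) ≠ 0 :=
      prod_ne_zero_iff.mpr fun j _ => qNum_ne_zero hq (Nat.succ_pos _)
    have h := congrFun (congrArg (fun x => seqRep q x (Pi.single (t + d.toNat) 1)) hs)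
      (t + (-d).toNat)
    simp only [map_sum, map_smul, map_zero, LinearMap.sum_apply, LinearMap.smul_apply,
      Finset.sum_apply, Pi.smul_apply, LinearMap.zero_apply, Pi.zero_apply,
      seqRep_monoZ_single, smul_eq_mul, mul_ite, mul_zero] at h
    rw [← sum_filter] at h
    refine (mul_eq_zero.mp (?_ : (∏ j ∈ range (-d).toNat, qNum q (t + j + 1)) * _ = 0)).resolve_left
      hu
    rw [← h, Polynomial.eval_finsetSum, mul_sum]
    refine sum_congr rfl fun i _ => ?_
    rw [Polynomial.eval_monomial]; ring
  have hp0 : p = 0 := Polynomial.eq_zero_of_infinite_isRoot p <|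
    (Set.infinite_range_of_injective (pow_injective_of_pow_ne_one hq0 hq)).mono <| by
      rintro _ ⟨t, rfl⟩; exact hp t
  have hc : p.coeff e = g (d, e) := by
    simp only [p, Polynomial.finsetSum_coeff, Polynomial.coeff_monomial]
    have hm : (d, e) ∈ s.filter fun i => i.1 = d := mem_filter.mpr ⟨hde, rfl⟩
    refine (sum_eq_single_of_mem (d, e) hm ?_).trans (if_pos rfl)
    rintro ⟨d', e'⟩ h h'
    rw [mem_filter] at h
    rw [if_neg]
    rintro rfl
    exact h' (Prod.ext h.2 rfl)
  rw [← hc, hp0, Polynomial.coeff_zero]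

/-- The degree and the exponent of `[A,B]` in the basis vector of a label. -/
def basisExponents : BasisIndex → ℤ × ℕ
  | .BA => (0, 1)
  | .A => (1, 0)
  | .B => (-1, 0)
  | .P k l => ((l : ℕ), k + 1)
  | .Q k l => (-(l : ℕ), k + 1)
  | .G k => (0, k + 2)

lemma basisExponents_injective : Function.Injective basisExponents := by
  intro i j h
  rcases i with _ | _ | _ | ⟨k, l⟩ | ⟨k, l⟩ | k <;> rcases j with _ | _ | _ | ⟨m, n⟩ | ⟨m, n⟩ | m <;>
    simp only [basisExponents, Prod.mk.injEq] at h <;>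
    try have := l.pos
  all_goals try have := n.pos
  all_goals first
    | rfl
    | (exfalso; omega)
    | (obtain rfl : k = m := by omega
       try obtain rfl : l = n := PNat.eq (by omega)
       rfl)

/-- The sign of a basis vector relative to the corresponding monomial. -/
def basisSign (F : Type*) [Field F] : BasisIndex → Fˣ
  | .BA => -1
  | _ => 1

lemma basisVec_eq_smul_monoZ (q : F) (i : BasisIndex) :
    basisVec q i = basisSign F i • monoZ q (basisExponents i) := by
  cases i <;> simp [basisVec, basisSign, monoZ, basisExponents, vecBA_eq, vecP, vecQ, vecG, comAB,
    Units.neg_smul]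

lemma linearIndependent_basisVec {q : F} (hq0 : q ≠ 0) (hq : ∀ n : ℕ, 0 < n → q ^ n ≠ 1) :
    LinearIndependent F (basisVec q) := by
  have h := ((linearIndependent_monoZ hq0 hq).comp _ basisExponents_injective).units_smul
    (basisSign F)
  convert h using 1
  ext i
  exact basisVec_eq_smul_monoZ q i

end Independence

/-! ### The span of the vectors is the generated Lie algebra. -/

section Spanning

variable {F : Type*} [Field F]

lemma basisVec_mem_span (q : F) (i : BasisIndex) :
    basisVec q i ∈ Submodule.span F (Set.range (basisVec q)) :=
  Submodule.subset_span ⟨i, rfl⟩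

/-- The condition excludes exactly 1 and the powers A^l with l ≥ 2, the monomials missing from the
family. -/
lemma monoA_mem_span (q : F) {e l : ℕ} (h : 1 ≤ e ∨ l = 1) :
    monoA q e l ∈ Submodule.span F (Set.range (basisVec q)) := by
  rcases Nat.eq_zero_or_pos e with rfl | he
  · obtain rfl : l = 1 := by omega
    rw [← genA_eq_monoA]; exact basisVec_mem_span q .A
  obtain ⟨e, rfl⟩ := Nat.exists_eq_add_of_le' he
  rcases Nat.eq_zero_or_pos l with rfl | hl
  · cases e with
    | zero =>
      rw [← neg_mem_iff, ← vecBA_eq_monoA]; exact basisVec_mem_span q .BA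
    | succ e => rw [← vecG_eq_monoA]; exact basisVec_mem_span q (.G e)
  · exact basisVec_mem_span q (.P e ⟨l, hl⟩)

lemma monoB_mem_span (q : F) {e l : ℕ} (h : 1 ≤ e ∨ l = 1) :
    monoB q e l ∈ Submodule.span F (Set.range (basisVec q)) := by
  rcases Nat.eq_zero_or_pos e with rfl | he
  · obtain rfl : l = 1 := by omega
    rw [← genB_eq_monoB]; exact basisVec_mem_span q .B
  obtain ⟨e, rfl⟩ := Nat.exists_eq_add_of_le' he
  rcases Nat.eq_zero_or_pos l with rfl | hl
  · cases e with
    | zero =>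
      rw [← neg_mem_iff, ← vecBA_eq_monoB]; exact basisVec_mem_span q .BA
    | succ e => rw [← vecG_eq_monoB]; exact basisVec_mem_span q (.G e)
  · exact basisVec_mem_span q (.Q e ⟨l, hl⟩)

lemma basisVec_eq_mono (q : F) (i : BasisIndex) : ∃ (c : F) (e l : ℕ), (1 ≤ e ∨ l = 1) ∧
    (basisVec q i = c • monoA q e l ∨ basisVec q i = c • monoB q e l) := by
  cases i with
  | BA => exact ⟨-1, 1, 0, .inl le_rfl, .inl ((vecBA_eq_monoA q).trans (neg_one_smul _ _).symm)⟩
  | A => exact ⟨1, 0, 1, .inr rfl, .inl ((genA_eq_monoA q).trans (one_smul _ _).symm)⟩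
  | B => exact ⟨1, 0, 1, .inr rfl, .inr ((genB_eq_monoB q).trans (one_smul _ _).symm)⟩
  | P k l => exact ⟨1, k + 1, l, .inl (by omega), .inl (one_smul _ _).symm⟩
  | Q k l => exact ⟨1, k + 1, l, .inl (by omega), .inr (one_smul _ _).symm⟩
  | G k => exact ⟨1, k + 2, 0, .inl (by omega), .inl ((vecG_eq_monoA q k).trans (one_smul _ _).symm)⟩

lemma lie_monoA_monoA_mem_span (q : F) {e l f n : ℕ} (h : 1 ≤ e ∨ l = 1) (h' : 1 ≤ f ∨ n = 1) :
    ⁅monoA q e l, monoA q f n⁆ ∈ Submodule.span F (Set.range (basisVec q)) := by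
  rw [lie_monoA_monoA]
  rcases Nat.eq_zero_or_pos (e + f) with h0 | h0
  · obtain ⟨rfl, rfl⟩ := Nat.add_eq_zero_iff.mp h0
    -- With e = f = 0 both factors are powers of A, and the excluded monomial gets coefficient 0.
    simp
  · exact Submodule.smul_mem _ _ (monoA_mem_span q (.inl h0))

lemma lie_monoB_monoB_mem_span (q : F) {e l f n : ℕ} (h : 1 ≤ e ∨ l = 1) (h' : 1 ≤ f ∨ n = 1) :
    ⁅monoB q e l, monoB q f n⁆ ∈ Submodule.span F (Set.range (basisVec q)) := by
  rw [lie_monoB_monoB]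
  rcases Nat.eq_zero_or_pos (e + f) with h0 | h0
  · obtain ⟨rfl, rfl⟩ := Nat.add_eq_zero_iff.mp h0
    simp
  · exact Submodule.smul_mem _ _ (monoB_mem_span q (.inl h0))

lemma lie_monoA_monoB_mem_span {q : F} (hq0 : q ≠ 0) (hq : ∀ n : ℕ, 0 < n → q ^ n ≠ 1)
    {e l f n : ℕ} (h : 1 ≤ e ∨ l = 1) (h' : 1 ≤ f ∨ n = 1) :
    ⁅monoA q e l, monoB q f n⁆ ∈ Submodule.span F (Set.range (basisVec q)) := by
  have hq1 : q ≠ 1 := by simpa using hq 1 one_pos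
  rcases Nat.eq_zero_or_pos e with rfl | he <;> rcases Nat.eq_zero_or_pos f with rfl | hf
  · obtain rfl : l = 1 := by omega
    obtain rfl : n = 1 := by omega
    rw [← genA_eq_monoA, ← genB_eq_monoB, ← lie_skew, neg_mem_iff]
    exact basisVec_mem_span q .BA
  · obtain rfl : l = 1 := by omega
    rw [← genA_eq_monoA]
    cases n with
    | zero =>
      have : monoB q f 0 = monoA q f 0 := by simp [monoA, monoB]
      rw [this, genA_eq_monoA]
      exact lie_monoA_monoA_mem_span q h (.inl hf)
    | succ n =>
      rw [lie_genA_monoB hq0 hq1]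
      exact Submodule.smul_mem _ _ (sub_mem
        (Submodule.smul_mem _ _ (monoB_mem_span q (.inl (by omega))))
        (Submodule.smul_mem _ _ (monoB_mem_span q (.inl hf))))
  · obtain rfl : n = 1 := by omega
    rw [← genB_eq_monoB]
    cases l with
    | zero =>
      have : monoA q e 0 = monoB q e 0 := by simp [monoA, monoB]
      rw [this, genB_eq_monoB]
      exact lie_monoB_monoB_mem_span q (.inl he) h'
    | succ l =>
      rw [lie_monoA_genB hq0 hq1]
      exact Submodule.smul_mem _ _ (sub_mem
        (Submodule.smul_mem _ _ (monoA_mem_span q (.inl (by omega))))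
        (Submodule.smul_mem _ _ (monoA_mem_span q (.inl he))))
  · obtain ⟨k, rfl⟩ := Nat.exists_eq_add_of_le' he
    obtain ⟨m, rfl⟩ := Nat.exists_eq_add_of_le' hf
    rcases le_total n l with hnl | hnl
    · obtain ⟨d, rfl⟩ := Nat.exists_eq_add_of_le' hnl
      rw [lie_monoA_monoB hq0 hq]
      exact Submodule.smul_mem _ _ (sum_mem fun i _ =>
        Submodule.smul_mem _ _ (monoA_mem_span q (.inl (by omega))))
    · obtain ⟨d, rfl⟩ := Nat.exists_eq_add_of_le' hnl
      rw [lie_monoA_monoB' hq0 hq]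
      exact Submodule.smul_mem _ _ (sum_mem fun i _ =>
        Submodule.smul_mem _ _ (monoB_mem_span q (.inl (by omega))))

lemma lie_mem_span_basisVec {q : F} (hq0 : q ≠ 0) (hq : ∀ n : ℕ, 0 < n → q ^ n ≠ 1)
    {x y : Heis q} (hx : x ∈ Submodule.span F (Set.range (basisVec q)))
    (hy : y ∈ Submodule.span F (Set.range (basisVec q))) :
    ⁅x, y⁆ ∈ Submodule.span F (Set.range (basisVec q)) := by
  induction hx, hy using Submodule.span_induction₂ with
  | mem_mem x y hx hy =>
    obtain ⟨i, rfl⟩ := hx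
    obtain ⟨j, rfl⟩ := hy
    obtain ⟨c, e, l, h, hi⟩ := basisVec_eq_mono q i
    obtain ⟨c', f, n, h', hj⟩ := basisVec_eq_mono q j
    rcases hi with hi | hi <;> rcases hj with hj | hj <;> rw [hi, hj, smul_lie] <;>
      refine Submodule.smul_mem _ _ ?_ <;> rw [Ring.lie_def, mul_smul_comm, smul_mul_assoc,
        ← smul_sub, ← Ring.lie_def] <;> refine Submodule.smul_mem _ _ ?_
    · exact lie_monoA_monoA_mem_span q h h'
    · exact lie_monoA_monoB_mem_span hq0 hq h h'
    · rw [← lie_skew, neg_mem_iff]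
      exact lie_monoA_monoB_mem_span hq0 hq h' h
    · exact lie_monoB_monoB_mem_span q h h'
  | zero_left y hy => rw [zero_lie]; exact zero_mem _
  | zero_right x hx => rw [lie_zero]; exact zero_mem _
  | add_left x y z _ _ _ h1 h2 => rw [add_lie]; exact add_mem h1 h2
  | add_right x y z _ _ _ h1 h2 => rw [lie_add]; exact add_mem h1 h2
  | smul_left r x y _ _ h => rw [smul_lie]; exact Submodule.smul_mem _ _ h
  | smul_right r x y _ _ h => rw [lie_smul]; exact Submodule.smul_mem _ _ h

lemma lieHeis_le_span_basisVec {q : F} (hq0 : q ≠ 0) (hq : ∀ n : ℕ, 0 < n → q ^ n ≠ 1) :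
    (lieHeis q).toSubmodule ≤ Submodule.span F (Set.range (basisVec q)) := by
  let K : LieSubalgebra F (Heis q) :=
    { Submodule.span F (Set.range (basisVec q)) with
      lie_mem' := fun hx hy => lie_mem_span_basisVec hq0 hq hx hy }
  have h : lieHeis q ≤ K := by
    refine LieSubalgebra.lieSpan_le.mpr ?_
    rintro x (rfl | rfl)
    · exact basisVec_mem_span q .A
    · exact basisVec_mem_span q .B
  exact h

lemma genA_mem_lieHeis (q : F) : genA q ∈ lieHeis q :=
  LieSubalgebra.subset_lieSpan (by simp)

lemma genB_mem_lieHeis (q : F) : genB q ∈ lieHeis q :=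
  LieSubalgebra.subset_lieSpan (by simp)

lemma vecBA_mem_lieHeis (q : F) : vecBA q ∈ lieHeis q :=
  (lieHeis q).lie_mem (genB_mem_lieHeis q) (genA_mem_lieHeis q)

lemma comAB_mem_lieHeis (q : F) : comAB q ∈ lieHeis q :=
  (lieHeis q).lie_mem (genA_mem_lieHeis q) (genB_mem_lieHeis q)

/-- Bracketing with A raises the power of A in C A^l with factor 1 - q; bracketing with C raises the
power of C with factor 1 - q^(l+1). The latter needs a positive power of A, so pure powers of C
require another argument. -/
lemma monoA_mem_lieHeis {q : F} (hq : ∀ n : ℕ, 0 < n → q ^ n ≠ 1) (e l : ℕ) :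
    monoA q (e + 1) (l + 1) ∈ lieHeis q := by
  have hne : ∀ n : ℕ, 0 < n → 1 - q ^ n ≠ 0 := fun n hn => sub_ne_zero.mpr (hq n hn).symm
  have h1 : ∀ l, 0 < l → monoA q 1 l ∈ lieHeis q := by
    intro l hl
    induction l, hl using Nat.le_induction with
    | base =>
      have h := lie_monoA_monoA q 1 0 0 1
      have hm := (lieHeis q).lie_mem (comAB_mem_lieHeis q) (genA_mem_lieHeis q)
      rw [show comAB q = monoA q 1 0 by simp [monoA], genA_eq_monoA, h] at hm
      simp only [zero_mul, pow_zero, one_mul, zero_add, add_zero] at hm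
      exact ((lieHeis q).toSubmodule.smul_mem_iff (hne 1 one_pos)).mp hm
    | succ l hl ih =>
      have h := lie_monoA_monoA q 1 l 0 1
      have hm := (lieHeis q).lie_mem ih (genA_mem_lieHeis q)
      rw [genA_eq_monoA, h] at hm
      simp only [mul_zero, pow_zero, one_mul, add_zero] at hm
      exact ((lieHeis q).toSubmodule.smul_mem_iff (hne 1 one_pos)).mp hm
  induction e with
  | zero => exact h1 (l + 1) l.succ_pos
  | succ e ih =>
    have h := lie_monoA_monoA q 1 0 (e + 1) (l + 1)
    have hm := (lieHeis q).lie_mem (comAB_mem_lieHeis q) ih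
    rw [show comAB q = monoA q 1 0 by simp [monoA], h] at hm
    simp only [zero_mul, pow_zero, mul_one, zero_add] at hm
    rw [add_comm 1 (e + 1)] at hm
    exact ((lieHeis q).toSubmodule.smul_mem_iff (hne (l + 1) l.succ_pos)).mp hm

/-- Reversing brackets preserves Lie subalgebras, so the preimage under `swap` is one, and it
contains both generators. -/
lemma swap_mem_lieHeis {q : F} {x : Heis q} (hx : x ∈ lieHeis q) : swap q x ∈ lieHeis q := by
  let K : LieSubalgebra F (Heis q) :=
    { (lieHeis q).toSubmodule.comap (swap q) with
      lie_mem' := fun {x y} hx hy => by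
        change swap q ⁅x, y⁆ ∈ lieHeis q
        rw [swap_lie]
        exact (lieHeis q).lie_mem hy hx }
  have h : lieHeis q ≤ K := by
    refine LieSubalgebra.lieSpan_le.mpr ?_
    rintro x (rfl | rfl)
    · change swap q (genA q) ∈ lieHeis q
      rw [swap_genA]; exact genB_mem_lieHeis q
    · change swap q (genB q) ∈ lieHeis q
      rw [swap_genB]; exact genA_mem_lieHeis q
  exact h hx

/-- The bracket [C^(e+1) A, B] combines C^(e+2) and C^(e+1); the first can be solved for because
{e+2}_q ≠ 0. -/
lemma comAB_pow_mem_lieHeis {q : F} (hq0 : q ≠ 0) (hq : ∀ n : ℕ, 0 < n → q ^ n ≠ 1) (e : ℕ) :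
    monoA q (e + 1) 0 ∈ lieHeis q := by
  have hq1 : q ≠ 1 := by simpa using hq 1 one_pos
  induction e with
  | zero => simpa [monoA] using comAB_mem_lieHeis q
  | succ e ih =>
    have hm := (lieHeis q).lie_mem (monoA_mem_lieHeis hq e 0) (genB_mem_lieHeis q)
    rw [lie_monoA_genB hq0 hq1] at hm
    have hm' := ((lieHeis q).toSubmodule.smul_mem_iff
      (inv_ne_zero (pow_ne_zero (e + 1) hq0))).mp hm
    have hs := (Submodule.sub_mem_iff_left _ ((lieHeis q).toSubmodule.smul_mem _ ih)).mp hm'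
    exact ((lieHeis q).toSubmodule.smul_mem_iff (qNum_ne_zero hq (Nat.succ_pos _))).mp hs

lemma basisVec_mem_lieHeis {q : F} (hq0 : q ≠ 0) (hq : ∀ n : ℕ, 0 < n → q ^ n ≠ 1)
    (i : BasisIndex) : basisVec q i ∈ lieHeis q := by
  have hP : ∀ (k : ℕ) (l : ℕ+), monoA q (k + 1) l ∈ lieHeis q := fun k l => by
    rw [← PNat.natPred_add_one l]; exact monoA_mem_lieHeis hq k _
  cases i with
  | BA => exact vecBA_mem_lieHeis q
  | A => exact genA_mem_lieHeis q
  | B => exact genB_mem_lieHeis q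
  | P k l => exact hP k l
  | Q k l =>
    have h := swap_mem_lieHeis (hP k l)
    rwa [swap_monoA] at h
  | G k =>
    change vecG q k ∈ _
    rw [vecG_eq_monoA]; exact comAB_pow_mem_lieHeis hq0 hq (k + 1)

/-- The basis of the Lie subalgebra generated by `A` and `B`. -/
noncomputable def lieHeisBasis {q : F} (hq0 : q ≠ 0) (hq : ∀ n : ℕ, 0 < n → q ^ n ≠ 1) :
    Module.Basis BasisIndex F (lieHeis q) :=
  Module.Basis.mk (v := fun i => (⟨basisVec q i, basisVec_mem_lieHeis hq0 hq i⟩ : lieHeis q))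
    (LinearIndependent.of_comp (lieHeis q).toSubmodule.subtype (linearIndependent_basisVec hq0 hq))
    (by
      rintro ⟨x, hx⟩ -
      have h := lieHeis_le_span_basisVec hq0 hq hx
      have hr : Set.range (basisVec q) = (lieHeis q).toSubmodule.subtype ''
          Set.range (fun i => (⟨basisVec q i, basisVec_mem_lieHeis hq0 hq i⟩ : lieHeis q)) := by
        rw [← Set.range_comp]; rfl
      rw [hr, Submodule.span_image] at h
      obtain ⟨y, hy, hyx⟩ := h
      obtain rfl : y = ⟨x, hx⟩ := Subtype.ext hyx
      exact hy)

lemma coe_lieHeisBasis {q : F} (hq0 : q ≠ 0) (hq : ∀ n : ℕ, 0 < n → q ^ n ≠ 1)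
    (i : BasisIndex) : (lieHeisBasis hq0 hq i : Heis q) = basisVec q i := by
  rw [lieHeisBasis, Module.Basis.mk_apply]

end Spanning

end QHeisenberg

/-! ### The basis and its commutation table. -/

theorem mainTheorem2 {F : Type*} [Field F] (q : F) (hq0 : q ≠ 0)
    (hq : ∀ n : ℕ, 0 < n → q ^ n ≠ 1) :
    -- the vectors form a basis of the Lie subalgebra generated by `A` and `B`
    (∃ b : Module.Basis BasisIndex F (lieHeis q), ∀ i, (b i : Heis q) = basisVec q i) ∧
    -- row of `P(k,l) = [A,B]^(k+1) A^l`
    (∀ k l m n : ℕ, 1 ≤ l → 1 ≤ n → ⁅vecP q k l, vecP q m n⁆ =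
      (q ^ (l * (m + 1)) - q ^ (n * (k + 1))) • vecP q (k + m + 1) (l + n)) ∧
    (∀ k l : ℕ, 1 ≤ l → ⁅vecP q k l, genA q⁆ = (1 - q ^ (k + 1)) • vecP q k (l + 1)) ∧
    (∀ k l : ℕ, 1 ≤ l → ⁅vecP q k l, vecBA q⁆ = (1 - q ^ l) • vecP q (k + 1) l) ∧
    (∀ k l m : ℕ, 1 ≤ l → ⁅vecP q k l, vecG q m⁆ =
      (q ^ (l * (m + 2)) - 1) • vecP q (k + m + 2) l) ∧
    (∀ k l : ℕ, 2 ≤ l → ⁅vecP q k l, genB q⁆ =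
      (q ^ (k + 1))⁻¹ • (qNum q (k + l + 1) • vecP q (k + 1) (l - 1) -
        qNum q (k + 1) • vecP q k (l - 1))) ∧
    (∀ k : ℕ, 1 ≤ k → ⁅vecP q k 1, genB q⁆ =
      (q ^ (k + 1))⁻¹ • (qNum q (k + 2) • vecG q k - qNum q (k + 1) • vecG q (k - 1))) ∧
    (⁅vecP q 0 1, genB q⁆ = q⁻¹ • ((1 + q) • vecG q 0 + vecBA q)) ∧
    (∀ k l m n : ℕ, 1 ≤ n → n < l → ⁅vecP q k l, vecQ q m n⁆ =
      ((q - 1) ^ n)⁻¹ • ∑ i ∈ range (n + 1),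
        coeffC q i k l m n • vecP q (i + k + m + 1) (l - n)) ∧
    (∀ k l m n : ℕ, 1 ≤ l → l < n → ⁅vecP q k l, vecQ q m n⁆ =
      ((q - 1) ^ l)⁻¹ • ∑ i ∈ range (l + 1),
        coeffC q i m n k l • vecQ q (i + k + m + 1) (n - l)) ∧
    (∀ k l m : ℕ, 1 ≤ l → ⁅vecP q k l, vecQ q m l⁆ =
      ((q - 1) ^ l)⁻¹ • ∑ i ∈ range (l + 1), coeffC q i k l m l • vecG q (i + k + m)) ∧
    -- row of `A`
    (⁅genA q, genA q⁆ = 0) ∧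
    (⁅genA q, vecBA q⁆ = (1 - q) • vecP q 0 1) ∧
    (∀ m : ℕ, ⁅genA q, vecG q m⁆ = (q ^ (m + 2) - 1) • vecP q (m + 1) 1) ∧
    (⁅genA q, genB q⁆ = -vecBA q) ∧
    (∀ m n : ℕ, 2 ≤ n → ⁅genA q, vecQ q m n⁆ =
      (q ^ (m + 1))⁻¹ • (qNum q (m + n + 1) • vecQ q (m + 1) (n - 1) -
        qNum q (m + 1) • vecQ q m (n - 1))) ∧
    (∀ m : ℕ, 1 ≤ m → ⁅genA q, vecQ q m 1⁆ =
      (q ^ (m + 1))⁻¹ • (qNum q (m + 2) • vecG q m - qNum q (m + 1) • vecG q (m - 1))) ∧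
    (⁅genA q, vecQ q 0 1⁆ = q⁻¹ • ((1 + q) • vecG q 0 + vecBA q)) ∧
    -- row of `[BA]`
    (⁅vecBA q, vecBA q⁆ = 0) ∧
    (∀ m : ℕ, ⁅vecBA q, vecG q m⁆ = 0) ∧
    (⁅vecBA q, genB q⁆ = (1 - q) • vecQ q 0 1) ∧
    (∀ m n : ℕ, 1 ≤ n → ⁅vecBA q, vecQ q m n⁆ = (1 - q ^ n) • vecQ q (m + 1) n) ∧
    -- row of `G(k) = [A,B]^(k+2)`
    (∀ k m : ℕ, ⁅vecG q k, vecG q m⁆ = 0) ∧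
    (∀ k : ℕ, ⁅vecG q k, genB q⁆ = (q ^ (k + 2) - 1) • vecQ q (k + 1) 1) ∧
    (∀ k m n : ℕ, 1 ≤ n → ⁅vecG q k, vecQ q m n⁆ =
      (q ^ (n * (k + 2)) - 1) • vecQ q (k + m + 2) n) ∧
    -- row of `B`
    (⁅genB q, genB q⁆ = 0) ∧
    (∀ m n : ℕ, 1 ≤ n → ⁅genB q, vecQ q m n⁆ = (1 - q ^ (m + 1)) • vecQ q m (n + 1)) ∧
    -- row of `Q(k,l) = B^l [A,B]^(k+1)`
    (∀ k l m n : ℕ, 1 ≤ l → 1 ≤ n → ⁅vecQ q k l, vecQ q m n⁆ =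
      (q ^ (n * (k + 1)) - q ^ (l * (m + 1))) • vecQ q (k + m + 1) (l + n)) := by
  have hq1 : q ≠ 1 := by simpa using hq 1 one_pos
  refine ⟨⟨lieHeisBasis hq0 hq, coe_lieHeisBasis hq0 hq⟩, ?_, ?_, ?_, ?_, ?_, ?_, ?_, ?_, ?_, ?_,
    ?_, ?_, ?_, ?_, ?_, ?_, ?_, ?_, ?_, ?_, ?_, ?_, ?_, ?_, ?_, ?_, ?_⟩
  · intro k l m n _ _
    rw [vecP_eq_monoA, vecP_eq_monoA, lie_monoA_monoA, vecP_eq_monoA]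
    congr 2; ring
  · intro k l _
    rw [vecP_eq_monoA, genA_eq_monoA, lie_monoA_monoA, vecP_eq_monoA]
    simp
  · intro k l _
    rw [vecP_eq_monoA, vecBA_eq_monoA, lie_neg, lie_monoA_monoA, vecP_eq_monoA, ← neg_smul]
    simp
  · intro k l m _
    rw [vecP_eq_monoA, vecG_eq_monoA, lie_monoA_monoA, vecP_eq_monoA, add_zero, zero_mul, pow_zero]
    congr 2; ring
  · intro k l hl
    obtain ⟨l, rfl⟩ := Nat.exists_eq_add_of_le' hl
    rw [vecP_eq_monoA, show l + 2 = l + 1 + 1 by rfl, lie_monoA_genB hq0 hq1]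
    simp only [vecP_eq_monoA, Nat.add_sub_cancel]
    rw [show k + 1 + (l + 1) + 1 = k + (l + 1 + 1) + 1 by ring]
  · intro k hk
    obtain ⟨k, rfl⟩ := Nat.exists_eq_add_of_le' hk
    rw [vecP_eq_monoA, lie_monoA_genB hq0 hq1, vecG_eq_monoA, vecG_eq_monoA]
    rfl
  -- The lower term is now C itself, and C = -[BA] explains the plus sign.
  · rw [vecP_eq_monoA, lie_monoA_genB hq0 hq1, vecG_eq_monoA, vecBA_eq_monoA]
    simp [qNum_succ, qNum_zero, sub_eq_add_neg]
  · intro k l m n _ hl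
    obtain ⟨d, rfl⟩ := Nat.exists_eq_add_of_le' hl.le
    rw [vecP_eq_monoA, vecQ_eq_monoB, lie_monoA_monoB hq0 hq, Nat.add_sub_cancel]
    rfl
  · intro k l m n _ hl
    obtain ⟨d, rfl⟩ := Nat.exists_eq_add_of_le' hl.le
    rw [vecP_eq_monoA, vecQ_eq_monoB, lie_monoA_monoB' hq0 hq, Nat.add_sub_cancel]
    rfl
  · intro k l m _
    -- Equal exponents leave d = 0, where the surviving monomials are pure powers of C.
    have h := lie_monoA_monoB hq0 hq k 0 m l
    rw [zero_add] at h
    simp only [vecG_eq_monoA]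
    exact h
  · exact lie_self _
  · rw [genA_eq_monoA, vecBA_eq_monoA, lie_neg, lie_monoA_monoA, vecP_eq_monoA, ← neg_smul]
    simp
  · intro m
    rw [genA_eq_monoA, vecG_eq_monoA, lie_monoA_monoA, vecP_eq_monoA]
    simp
  · exact (lie_skew _ _).symm
  · intro m n hn
    obtain ⟨n, rfl⟩ := Nat.exists_eq_add_of_le' hn
    rw [vecQ_eq_monoB, show n + 2 = n + 1 + 1 by rfl, lie_genA_monoB hq0 hq1]
    simp only [vecQ_eq_monoB, Nat.add_sub_cancel]
    rw [show m + 1 + (n + 1) + 1 = m + (n + 1 + 1) + 1 by ring]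
  · intro m hm
    obtain ⟨m, rfl⟩ := Nat.exists_eq_add_of_le' hm
    rw [vecQ_eq_monoB, lie_genA_monoB hq0 hq1, vecG_eq_monoB, vecG_eq_monoB]
    rfl
  · rw [vecQ_eq_monoB, lie_genA_monoB hq0 hq1, vecG_eq_monoB, vecBA_eq_monoB]
    simp [qNum_succ, qNum_zero, sub_eq_add_neg]
  · exact lie_self _
  · intro m
    rw [vecBA_eq_monoA, vecG_eq_monoA, neg_lie, lie_monoA_monoA]
    simp
  · rw [vecBA_eq_monoB, genB_eq_monoB, neg_lie, lie_monoB_monoB, vecQ_eq_monoB, ← neg_smul]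
    simp
  · intro m n _
    rw [vecBA_eq_monoB, vecQ_eq_monoB, neg_lie, lie_monoB_monoB, vecQ_eq_monoB, ← neg_smul,
      zero_add, zero_mul, add_comm 1 (m + 1)]
    simp
  · intro k m
    rw [vecG_eq_monoA, vecG_eq_monoA, lie_monoA_monoA]
    simp
  · intro k
    rw [vecG_eq_monoB, genB_eq_monoB, lie_monoB_monoB, vecQ_eq_monoB]
    simp
  · intro k m n _
    rw [vecG_eq_monoB, vecQ_eq_monoB, lie_monoB_monoB, vecQ_eq_monoB, zero_add, zero_mul, pow_zero]
    congr 2; ring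
  · exact lie_self _
  · intro m n _
    rw [genB_eq_monoB, vecQ_eq_monoB, lie_monoB_monoB, vecQ_eq_monoB, zero_add, add_comm 1 n]
    simp
  · intro k l m n _ _
    rw [vecQ_eq_monoB, vecQ_eq_monoB, lie_monoB_monoB, vecQ_eq_monoB]
    congr 2; ring
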